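/- Let $\sigma(t)=\max(-1,\min(t,1))$ be the hard-tanh activation. For $L\ge 3$ and positive integer widths $d_0=d_x,d_1,\dots,d_{L-1},d_L=d_y$, an $L$-layer hard-tanh FNN computes $a^0(x)=x$, $a^l(x)=\sigma(W^l a^{l-1}(x)+b^l)$ entrywise for $1\le l\le L-1$, and $f_\theta(x)=W^L a^{L-1}(x)+b^L$, where $W^l\in\mathbb R^{d_l\times d_{l-1}}$, $b^l\in\mathbb R^{d_l}$ and $\theta=(W^l,b^l)_{l=1}^L$. (a) Let $\{(x_i,y_i)\}_{i=1}^N$ be any dataset with pairwise distinct $x_i\in\mathbb R^{d_x}$ and $y_i\in[-1,1]^{d_y}$. Suppose that there are $m\ge 1$ and indices $l_1,\dots,l_m\in\{1,\dots,L-2\}$ such that, with $r_j=d_y\mathbf 1\{j>1\}+\mathbf 1\{j<m\}$, - $l_j+1<l_{j+1}$ for $1\le j\le m-1$; - $d_{l_j}\ge r_j$ and $d_{l_j+1}\ge r_j$ for $1\le j\le m$, and $$4\sum_{j=1}^m\left\lfloor\frac{d_{l_j}-r_j}{2}\right\rfloor\left\lfloor\frac{d_{l_j+1}-r_j}{2d_y}\right\rfloor\ge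 N;$$ - $d_k\ge d_y+1$ for all $k$ with $l_j+2\le k\le l_{j+1}-1$ for some $1\le j\le m-1$; - $d_k\ge d_y$ for all $k$ with $l_m+2\le k\le L-1$. Then there exists $\theta$ such that $f_\theta(x_i)=y_i$ for all $i\in\{1,\dots,N\}$. (b) Let the memorization capacity of a network with $d_y=1$ be the supremum of all $N$ such that for all pairwise distinct $x_1,\dots,x_N\in\mathbb R^{d_x}$ and all $y_1,\dots,y_N\in[-1,1]$ there exists $\theta$ with $f_\theta(x_i)=y_i$ for all $i$. There is an absolute constant $c>0$ such that, whenever $L\ge3$, $d_y=1$ and all hidden widths $d_1,\dots,d_{L-1}$ are at least $4$, the memorization capacity is at least $c\sum_{l=1}^{L-2}d_ld_{l+1}$. Consequently, for each fixed $d_x$ there is $c_{d_x}>0$, depending only on $d_x$, such that under the same conditions the memorization capacity is at least $c_{d_x}W$, where $W=\sum_{l=1}^{L}d_{l-1}d_l$ is the number of edges of the network. -/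

import Mathlib

noncomputable section

/-- The hard-tanh activation. -/
def hardTanh (t : ℝ) : ℝ :=
  if t ≤ -1 then -1 else if t ≤ 1 then t else 1

/-- Parameters of an `L`-layer fully-connected network whose layer widths are
`d 0` (input dimension), `d 1, …, d (L - 1)` (hidden widths), `d L` (output dimension).
`W l` and `b l` map layer `l` to layer `l + 1`, for `l = 0, …, L - 1`; the values of `d`
beyond `L` play no role. -/
structure FNNParams (d : ℕ → ℕ) (L : ℕ) where
  W : (l : Fin L) → Matrix (Fin (d (l + 1))) (Fin (d l)) ℝ
  b : (l : Fin L) → Fin (d (l + 1)) → ℝ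

namespace FNNParams

/-- `θ.act σ x l` is the output of the `l`-th layer with the activation `σ` applied
entrywise: `a⁰(x) = x` and `aˡ⁺¹(x) = σ (W aˡ(x) + b)`. -/
def act {d : ℕ → ℕ} {L : ℕ} (σ : ℝ → ℝ) (θ : FNNParams d L) (x : Fin (d 0) → ℝ) :
    (l : ℕ) → l ≤ L → Fin (d l) → ℝ
  | 0, _ => x
  | l + 1, h => fun i =>
      σ (((θ.W ⟨l, h⟩).mulVec (act σ θ x l (Nat.le_of_succ_le h)) + θ.b ⟨l, h⟩) i)

/-- The network function: the last layer is affine, with no activation.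
(`L = 0` is a degenerate case that is never used.) -/
def output {d : ℕ → ℕ} (σ : ℝ → ℝ) :
    {L : ℕ} → FNNParams d L → (Fin (d 0) → ℝ) → Fin (d L) → ℝ
  | 0, _, x => x
  | l + 1, θ, x =>
      (θ.W ⟨l, Nat.lt_succ_self l⟩).mulVec (θ.act σ x l (Nat.le_succ l))
        + θ.b ⟨l, Nat.lt_succ_self l⟩

end FNNParams

/-- Universal finite sample expressivity for `N` points: every dataset with distinct inputs
and labels in `[-1, 1]^{d_y}` is fitted exactly by some choice of the parameters. -/
def FiniteSampleExpressive (σ : ℝ → ℝ) (d : ℕ → ℕ) (L N : ℕ) : Prop :=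
  ∀ x : Fin N → Fin (d 0) → ℝ, Function.Injective x →
  ∀ y : Fin N → Fin (d L) → ℝ, (∀ i c, y i c ∈ Set.Icc (-1 : ℝ) 1) →
    ∃ θ : FNNParams d L, ∀ i, θ.output σ (x i) = y i

/-- Memorization capacity (meant for output dimension `d L = 1`): the largest number of
points for which the network has finite sample expressivity. -/
def memorizationCapacity (σ : ℝ → ℝ) (d : ℕ → ℕ) (L : ℕ) : ℕ∞ :=
  ⨆ N : {N : ℕ // FiniteSampleExpressive σ d L N}, ((N : ℕ) : ℕ∞)

/-- `r_j = d_y 𝟙{j > 1} + 𝟙{j < m}`. -/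
def reservedNodes (dy m j : ℕ) : ℕ :=
  dy * (if 1 < j then 1 else 0) + (if j < m then 1 else 0)

/-- Number of edges between adjacent hidden layers, `∑_{l=1}^{L-2} d_l d_{l+1}`
(used for `3 ≤ L`). -/
def hiddenEdgeCount (d : ℕ → ℕ) (L : ℕ) : ℕ :=
  ∑ l ∈ Finset.Icc 1 (L - 2), d l * d (l + 1)

/-- Number of edges of the whole network, `∑_{l=0}^{L-1} d_l d_{l+1}`. -/
def edgeCount (d : ℕ → ℕ) (L : ℕ) : ℕ :=
  ∑ l ∈ Finset.range L, d l * d (l + 1)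

end

/-!
A generic linear functional separates the inputs, so the sample may be taken to consist of points
`τ 1 < τ 2 < ⋯` on a line, and the sorted sample is cut into consecutive chunks. Each chunk is fitted
by one block of two consecutive hidden layers (`Reachable.chunk`), which leaves the other points alone.

Consider a chunk of `p` groups of `q` points, with `q` even, and one output coordinate. The `g`-th
node of the first layer increases on the `g`-th group and is saturated elsewhere. A second-layer node
sees a linear combination of these `p` functions whose graph is a zigzag with one long edge in each
group. As the start of the zigzag tends to `-∞`, all edges become long and steep, while the edge in
each group can still be made to pass through a prescribed value at one prescribed point
(`exists_zigzag`). So the node outputs the prescribed labels at `p` points, one in each group, and is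
saturated at all others (`GroupNodes.exists_node`). The `q` nodes, with alternating orientations, take
care of the `q` positions; going through the positions backwards in every other group compensates the
sign of the slopes, and the saturated nodes add up to the constant `1` (`sum_alternating`). In total
the block outputs label plus `1` on its chunk, and `0` on the other points
(`GroupNodes.exists_chunk`).

Adding these outputs to the constant `-1` gives, after `j` blocks, the label at the points of the first
`j` chunks and `-1` at the others. These values lie in `[-1, 1]`, where the activation is the identity,
so together with the projected input they are passed on to the next block through the reserved nodes
(`finiteSampleExpressive_of_blocks`). Since only the affine combinations of the activations of a layer
matter, the bookkeeping is done with the submodule of functions on the sample that are affine in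
these activations (`Reachable`).

For the capacity, blocks starting at all odd layers, or at all even layers, are admissible; at
least a ninth of the product of the widths of each block is fitted, and the odd and the even layers
together account for all hidden edges.
-/

/-! ### Features computable by the hidden layers -/

lemma hardTanh_eq_self {t : ℝ} (h : t ∈ Set.Icc (-1 : ℝ) 1) : hardTanh t = t := by
  obtain ⟨h1, h2⟩ := h
  unfold hardTanh
  split_ifs <;> linarith

lemma hardTanh_of_le {t : ℝ} (h : t ≤ -1) : hardTanh t = -1 := if_pos h

lemma hardTanh_of_ge {t : ℝ} (h : 1 ≤ t) : hardTanh t = 1 := by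
  unfold hardTanh
  split_ifs <;> linarith

lemma hardTanh_neg (t : ℝ) : hardTanh (-t) = -hardTanh t := by
  unfold hardTanh
  split_ifs <;> linarith

namespace FNNParams

variable {d : ℕ → ℕ} {L : ℕ}

/-- The parameters `θ` with the weights and biases leading to layer `k + 1` replaced. -/
noncomputable def updateLayer (θ : FNNParams d L) (k : Fin L)
    (W : Matrix (Fin (d (k + 1))) (Fin (d k)) ℝ) (b : Fin (d (k + 1)) → ℝ) : FNNParams d L where
  W := Function.update θ.W k W
  b := Function.update θ.b k b

lemma act_updateLayer (σ : ℝ → ℝ) (θ : FNNParams d L) (k : Fin L)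
    (W : Matrix (Fin (d (k + 1))) (Fin (d k)) ℝ) (b : Fin (d (k + 1)) → ℝ) (x : Fin (d 0) → ℝ) :
    ∀ (l : ℕ) (h : l ≤ L), l ≤ k →
      (θ.updateLayer k W b).act σ x l h = θ.act σ x l h
  | 0, _, _ => rfl
  | l + 1, h, hl => by
      have ih := act_updateLayer σ θ k W b x l (Nat.le_of_succ_le h) (by omega)
      have hne : (⟨l, h⟩ : Fin L) ≠ k := by
        rintro rfl
        simp at hl
      funext i
      simp only [act, ih]
      simp only [updateLayer, Function.update_of_ne hne]

end FNNParams

/-- For a sample `x`, all functions in `U` (given by their values on the sample points) can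
simultaneously be made affine functions of the activations of layer `l`, by a choice of the
parameters up to that layer. -/
def Reachable {X : Type*} (d : ℕ → ℕ) (x : X → Fin (d 0) → ℝ) (l : ℕ)
    (U : Submodule ℝ (X → ℝ)) : Prop :=
  ∃ A : X → Fin (d l) → ℝ,
    (∀ (L : ℕ) (h : l ≤ L), ∃ θ : FNNParams d L, ∀ i, θ.act hardTanh (x i) l h = A i) ∧
    ∀ f ∈ U, ∃ (w : Fin (d l) → ℝ) (b : ℝ), ∀ i, f i = w ⬝ᵥ A i + b

/-- The functions on the sample that are affine combinations of those in `G`. -/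
def affineHull {X : Type*} (G : Set (X → ℝ)) : Submodule ℝ (X → ℝ) :=
  Submodule.span ℝ (insert 1 G)

namespace affineHull

variable {X : Type*} {G : Set (X → ℝ)}

lemma mem_of_mem {f : X → ℝ} (h : f ∈ G) : f ∈ affineHull G :=
  Submodule.subset_span (Set.mem_insert_of_mem _ h)

lemma const_mem (c : ℝ) : (fun _ => c) ∈ affineHull G := by
  have := (affineHull G).smul_mem c (Submodule.subset_span (Set.mem_insert (1 : X → ℝ) G))
  convert this using 1
  ext
  simp

lemma affine_mem {f : X → ℝ} (h : f ∈ affineHull G) (a b : ℝ) :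
    (fun i => a * f i + b) ∈ affineHull G :=
  (affineHull G).add_mem ((affineHull G).smul_mem a h) (const_mem b)

lemma sum_mem {ι : Type*} (s : Finset ι) {f : ι → X → ℝ} (h : ∀ k ∈ s, f k ∈ affineHull G) :
    (fun i => ∑ k ∈ s, f k i) ∈ affineHull G := by
  convert (affineHull G).sum_mem h using 1
  ext
  simp

lemma le_affineHull_iff {H : Set (X → ℝ)} : affineHull G ≤ affineHull H ↔ G ⊆ affineHull H := by
  have h : (1 : X → ℝ) ∈ affineHull H := const_mem 1
  rw [affineHull, Submodule.span_le, Set.insert_subset_iff]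
  exact and_iff_right h

end affineHull

namespace Reachable

variable {X : Type*} {d : ℕ → ℕ} {x : X → Fin (d 0) → ℝ} {l : ℕ}

lemma mono {U V : Submodule ℝ (X → ℝ)} (h : Reachable d x l V) (hUV : U ≤ V) :
    Reachable d x l U := by
  obtain ⟨A, hA, hV⟩ := h
  exact ⟨A, hA, fun f hf => hV f (hUV hf)⟩

lemma affineHull_of_forall {G : Set (X → ℝ)} {A : X → Fin (d l) → ℝ}
    (hA : ∀ (L : ℕ) (h : l ≤ L), ∃ θ : FNNParams d L, ∀ i, θ.act hardTanh (x i) l h = A i)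
    (hG : ∀ f ∈ G, ∃ (w : Fin (d l) → ℝ) (b : ℝ), ∀ i, f i = w ⬝ᵥ A i + b) :
    Reachable d x l (affineHull G) := by
  refine ⟨A, hA, fun f hf => ?_⟩
  induction hf using Submodule.span_induction with
  | mem f hf =>
    rcases hf with rfl | hf
    · exact ⟨0, 1, by simp⟩
    · exact hG f hf
  | zero => exact ⟨0, 0, by simp⟩
  | add f g _ _ hf hg =>
    obtain ⟨w, b, h⟩ := hf
    obtain ⟨w', b', h'⟩ := hg
    refine ⟨w + w', b + b', fun i => ?_⟩
    rw [Pi.add_apply, h, h', add_dotProduct]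
    ring
  | smul c f _ hf =>
    obtain ⟨w, b, h⟩ := hf
    refine ⟨c • w, c * b, fun i => ?_⟩
    rw [Pi.smul_apply, h, smul_dotProduct, smul_eq_mul, smul_eq_mul]
    ring

lemma input {f : X → ℝ} (w : Fin (d 0) → ℝ) (b : ℝ) (h : ∀ i, f i = w ⬝ᵥ x i + b) :
    Reachable d x 0 (affineHull {f}) :=
  affineHull_of_forall (A := x) (fun _ _ => ⟨⟨0, 0⟩, fun _ => rfl⟩)
    (by rintro _ rfl; exact ⟨w, b, h⟩)

/-- One more hidden layer computes any `d (l + 1)` functions obtained by applying the activation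
to reachable functions. -/
lemma succ {U : Submodule ℝ (X → ℝ)} (h : Reachable d x l U) (G : Finset (X → ℝ))
    (hcard : G.card ≤ d (l + 1)) (hG : ∀ g ∈ G, ∃ f ∈ U, ∀ i, g i = hardTanh (f i)) :
    Reachable d x (l + 1) (affineHull (G : Set (X → ℝ))) := by
  obtain ⟨A, hA, hU⟩ := h
  obtain ⟨e⟩ : Nonempty (G ↪ Fin (d (l + 1))) :=
    Function.Embedding.nonempty_of_card_le (by simpa using hcard)
  have hG' : ∀ g : G, ∃ (w : Fin (d l) → ℝ) (b : ℝ), ∀ i, g.1 i = hardTanh (w ⬝ᵥ A i + b) := by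
    intro g
    obtain ⟨f, hf, hgf⟩ := hG g.1 g.2
    obtain ⟨w, b, hwb⟩ := hU f hf
    exact ⟨w, b, fun i => by rw [hgf, hwb]⟩
  choose w b hwb using hG'
  -- Nodes outside the range of `e` are idle, with weights and bias zero.
  set W : Matrix (Fin (d (l + 1))) (Fin (d l)) ℝ := Function.extend e w 0 with hW
  set B : Fin (d (l + 1)) → ℝ := Function.extend e b 0 with hB
  refine affineHull_of_forall (A := fun i c => hardTanh ((W.mulVec (A i) + B) c)) ?_ ?_
  · intro L hL
    obtain ⟨θ, hθ⟩ := hA L (Nat.le_of_succ_le hL)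
    refine ⟨θ.updateLayer ⟨l, hL⟩ W B, fun i => ?_⟩
    funext c
    simp only [FNNParams.act]
    rw [FNNParams.act_updateLayer _ _ _ _ _ _ _ _ le_rfl, hθ]
    simp [FNNParams.updateLayer]
  · intro g hg
    refine ⟨Pi.single (e ⟨g, hg⟩) 1, 0, fun i => ?_⟩
    rw [single_one_dotProduct, add_zero, Pi.add_apply, Matrix.mulVec, hW, hB,
      e.injective.extend_apply, e.injective.extend_apply]
    exact hwb ⟨g, hg⟩ i

/-- Functions with values in `[-1, 1]` are passed unchanged through further hidden layers. -/
lemma pass {G : Finset (X → ℝ)} (h : Reachable d x l (affineHull (G : Set (X → ℝ))))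
    (hG : ∀ g ∈ G, ∀ i, g i ∈ Set.Icc (-1 : ℝ) 1) (k : ℕ) (hlk : l ≤ k)
    (hd : ∀ j, l < j → j ≤ k → G.card ≤ d j) :
    Reachable d x k (affineHull (G : Set (X → ℝ))) := by
  induction k, hlk using Nat.le_induction with
  | base => exact h
  | succ k hlk ih =>
    refine (ih fun j h1 h2 => hd j h1 (by omega)).succ G (hd _ (by omega) le_rfl) fun g hg => ?_
    exact ⟨g, affineHull.mem_of_mem hg, fun i => (hardTanh_eq_self (hG g hg i)).symm⟩

lemma exists_output {y : X → Fin (d (l + 1)) → ℝ} {U : Submodule ℝ (X → ℝ)}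
    (h : Reachable d x l U) (hy : ∀ c, (fun i => y i c) ∈ U) :
    ∃ θ : FNNParams d (l + 1), ∀ i, θ.output hardTanh (x i) = y i := by
  obtain ⟨A, hA, hU⟩ := h
  obtain ⟨θ, hθ⟩ := hA (l + 1) (Nat.le_succ l)
  choose w b hwb using fun c => hU _ (hy c)
  set W : Matrix (Fin (d (l + 1))) (Fin (d l)) ℝ := w with hW
  refine ⟨θ.updateLayer ⟨l, Nat.lt_succ_self l⟩ W b, fun i => ?_⟩
  simp only [FNNParams.output]
  rw [FNNParams.act_updateLayer _ _ _ _ _ _ _ _ le_rfl, hθ]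
  funext c
  simpa [FNNParams.updateLayer, Matrix.mulVec] using (hwb c i).symm

end Reachable

/-! ### Zigzag nodes -/

open Filter in
/-- A zigzag path: `β g` is its height after `g` steps of size `2 * W g`, it passes through `y g`
at the fraction `(1 + θ g) / 2` of step `g`, and it starts so low that the first `p` steps are long,
with end points far from `0` and of alternating sign. -/
lemma exists_zigzag (p : ℕ) (θ y : ℕ → ℝ) (hθ : ∀ g, θ g ∈ Set.Ioo (-1 : ℝ) 1) (K : ℝ) :
    ∃ W β : ℕ → ℝ, (∀ g, β (g + 1) = β g + 2 * W g) ∧ (∀ g, β g + W g * (1 + θ g) = y g) ∧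
      (∀ g ≤ p, K ≤ (-1) ^ (g + 1) * β g) ∧ ∀ g < p, K ≤ (-1) ^ g * W g := by
  let β : ℝ → ℕ → ℝ := fun M g => Nat.rec (-M) (fun g r => r + 2 * ((y g - r) / (1 + θ g))) g
  have hpos : ∀ g, 0 < 1 + θ g := fun g => by linarith [(hθ g).1]
  have hsq : ∀ g : ℕ, ((-1 : ℝ) ^ g) * (-1) ^ g = 1 := fun g => by
    rw [← mul_pow]; norm_num
  have hβ0 : ∀ M, β M 0 = -M := fun _ => rfl
  have hβ : ∀ M g, β M (g + 1) = β M g + 2 * ((y g - β M g) / (1 + θ g)) := fun _ _ => rfl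
  -- All heights grow with the depth `M` of the starting point.
  have hlim : ∀ g, Tendsto (fun M => (-1) ^ (g + 1) * β M g) atTop atTop := by
    intro g
    induction g with
    | zero =>
      refine tendsto_id.congr fun M => ?_
      simp [hβ0]
    | succ g ih =>
      have h1 : 0 < (1 - θ g) / (1 + θ g) := div_pos (by linarith [(hθ g).2]) (hpos g)
      refine (tendsto_atTop_add_const_left _ ((-1) ^ g * (2 * y g / (1 + θ g)))
        (ih.const_mul_atTop h1)).congr fun M => ?_
      rw [hβ]
      have := (hpos g).ne'
      field_simp
      ring
  have hlimW : ∀ g, Tendsto (fun M => (-1) ^ g * ((y g - β M g) / (1 + θ g))) atTop atTop := by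
    intro g
    refine (tendsto_atTop_add_const_left _ ((-1) ^ g * (y g / (1 + θ g)))
      ((hlim g).const_mul_atTop (inv_pos.2 (hpos g)))).congr fun M => ?_
    have := (hpos g).ne'
    field_simp
    ring
  have h1 : ∀ᶠ M in atTop, ∀ g ∈ Finset.range (p + 1), K ≤ (-1) ^ (g + 1) * β M g :=
    (Finset.eventually_all _).2 fun g _ => (hlim g).eventually_ge_atTop K
  have h2 : ∀ᶠ M in atTop, ∀ g ∈ Finset.range p, K ≤ (-1) ^ g * ((y g - β M g) / (1 + θ g)) :=
    (Finset.eventually_all _).2 fun g _ => (hlimW g).eventually_ge_atTop K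
  obtain ⟨M, hM1, hM2⟩ := (h1.and h2).exists
  refine ⟨fun g => (y g - β M g) / (1 + θ g), β M, hβ M, fun g => ?_, fun g hg => ?_, fun g hg => ?_⟩
  · rw [div_mul_cancel₀ _ (hpos g).ne']
    ring
  · exact hM1 g (by simpa [Nat.lt_succ_iff] using hg)
  · exact hM2 g (by simpa using hg)

/-- The position, within the `g`-th group of `q` consecutive points, of the point that is fitted
by node `k`: the groups are run through alternately forwards and backwards, following the
alternating slopes of the zigzag. -/
def slot (q g k : ℕ) : ℕ := if Even g then k else q - 1 - k

lemma slot_lt {q g k : ℕ} (hk : k < q) : slot q g k < q := by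
  unfold slot
  split_ifs <;> omega

/-- Outputs of a family of first-layer nodes: node `g` separates the points of the `g`-th
group `[n + g * q, n + (g + 1) * q)`, in increasing order, and is saturated at all others. -/
structure GroupNodes (a : ℕ → ℕ → ℝ) (n q : ℕ) : Prop where
  before : ∀ g i, i < n + g * q → a g i = -1
  after : ∀ g i, n + (g + 1) * q ≤ i → a g i = 1
  inside : ∀ g s, s < q → a g (n + g * q + s) ∈ Set.Ioo (-1 : ℝ) 1
  lt : ∀ g s s', s < s' → s' < q → a g (n + g * q + s) < a g (n + g * q + s')

/-- A second-layer node of a zigzag that has the prescribed value at one point of each group and is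
saturated at all other points. Node `slot q g s` is the one fitting point `s` of group `g`;
at this point the nodes `k` before it are at `1` and those after it at `-1`, in every group. -/
lemma GroupNodes.exists_node {a : ℕ → ℕ → ℝ} {n q : ℕ} (ha : GroupNodes a n q) (p : ℕ) {k : ℕ}
    (hk : k < q) {y : ℕ → ℝ} (hy1 : ∀ i, |y i| ≤ 1) :
    ∃ (b : ℝ) (W z : ℕ → ℝ), (∀ i, z i = b + ∑ g ∈ Finset.range p, W g * a g i) ∧
      (∀ i < n, hardTanh (z i) = -1) ∧
      (∀ i, n + p * q ≤ i → hardTanh (z i) = (-1) ^ (p + 1)) ∧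
      ∀ g < p, ∀ s < q, hardTanh (z (n + g * q + s)) =
        if k < slot q g s then 1 else if k = slot q g s then y (n + g * q + s) else -1 := by
  set θ : ℕ → ℝ := fun g => a g (n + g * q + slot q g k) with hθ
  -- `K` is large enough for slopes `≥ K` to saturate the neighbours of the fitted points.
  obtain ⟨K, hK1, hK⟩ : ∃ K : ℝ, 1 ≤ K ∧ ∀ g < p, ∀ s < q, s ≠ slot q g k →
      2 ≤ K * |a g (n + g * q + s) - θ g| := by
    have h : ∀ᶠ K : ℝ in Filter.atTop, ∀ g ∈ Finset.range p, ∀ s ∈ Finset.range q,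
        s ≠ slot q g k → 2 ≤ K * |a g (n + g * q + s) - θ g| := by
      refine (Finset.eventually_all _).2 fun g _ => (Finset.eventually_all _).2 fun s hs => ?_
      by_cases hsk : s = slot q g k
      · simp [hsk]
      have hne : a g (n + g * q + s) - θ g ≠ 0 := by
        have hs := Finset.mem_range.1 hs
        rcases Nat.lt_or_gt_of_ne hsk with h | h
        · exact (sub_neg.2 (ha.lt g _ _ h (slot_lt hk))).ne
        · exact (sub_pos.2 (ha.lt g _ _ h hs)).ne'
      exact ((Filter.tendsto_id.atTop_mul_const (abs_pos.2 hne)).eventually_ge_atTop 2).mono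
        fun K hK _ => hK
    obtain ⟨K, hK, h1⟩ := (h.and (Filter.eventually_ge_atTop 1)).exists
    exact ⟨K, h1, fun g hg s hs => hK g (by simpa) s (by simpa)⟩
  obtain ⟨W, β, hβ, hy, hβK, hWK⟩ :=
    exists_zigzag p θ (fun g => y (n + g * q + slot q g k)) (fun g => ha.inside g _ (slot_lt hk)) K
  have hz : ∀ i, β 0 + ∑ g ∈ Finset.range p, W g + ∑ g ∈ Finset.range p, W g * a g i =
      β 0 + ∑ g ∈ Finset.range p, W g * (1 + a g i) := fun i => by
    simp only [mul_add, mul_one, Finset.sum_add_distrib, add_assoc]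
  have htel : ∀ i P, (∀ g < P, a g i = 1) →
      β 0 + ∑ g ∈ Finset.range P, W g * (1 + a g i) = β P := by
    intro i P
    induction P with
    | zero => simp
    | succ P ih =>
      intro h
      rw [Finset.sum_range_succ, ← add_assoc, ih fun g hg => h g (by omega), hβ, h P (by omega)]
      ring
  have hmul : ∀ {g g' : ℕ}, g < g' → (g + 1) * q ≤ g' * q := fun h => Nat.mul_le_mul_right q h
  refine ⟨β 0 + ∑ g ∈ Finset.range p, W g, W, _, fun i => rfl, fun i hi => ?_,
    fun i hi => ?_, fun g hg s hs => ?_⟩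
  · rw [hz, Finset.sum_eq_zero fun g _ => by rw [ha.before g i (by omega)]; ring]
    have := hβK 0 (Nat.zero_le _)
    simp only [zero_add, pow_one] at this
    exact hardTanh_of_le (by linarith)
  · rw [hz, htel i p fun g hg => ha.after g i (by have := hmul hg; omega)]
    have := hK1.trans (hβK p le_rfl)
    rcases neg_one_pow_eq_or ℝ (p + 1) with h | h <;> rw [h] at this ⊢
    · exact hardTanh_of_ge (by linarith)
    · exact hardTanh_of_le (by linarith)
  · have hval : ∀ P, g < P → β 0 + ∑ g' ∈ Finset.range P, W g' * (1 + a g' (n + g * q + s)) =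
        β g + W g * (1 + a g (n + g * q + s)) := by
      intro P hP
      induction P, hP using Nat.le_induction with
      | base =>
        rw [Finset.sum_range_succ, ← add_assoc, htel _ g fun g' hg' => ha.after g' _ (by
          have := hmul hg'; omega)]
      | succ P hP ih =>
        rw [Finset.sum_range_succ, ← add_assoc, ih, ha.before P _ (by
          have := hmul hP; rw [Nat.succ_mul] at this; omega)]
        ring
    have hval' : β 0 + ∑ g ∈ Finset.range p, W g +
        ∑ g' ∈ Finset.range p, W g' * a g' (n + g * q + s) =
        y (n + g * q + slot q g k) + W g * (a g (n + g * q + s) - θ g) := by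
      rw [hz, hval p hg, ← hy g]
      ring
    rw [hval']
    have hy2 := abs_le.1 (hy1 (n + g * q + slot q g k))
    have hW := hWK g hg
    -- The height at `s` relative to the fitted value, multiplied by the sign of the slope.
    have hlt : s < slot q g k → (-1) ^ g * W g * (a g (n + g * q + s) - θ g) ≤ -2 := fun h => by
      have h1 := hK g hg s hs h.ne
      have h2 := sub_neg.2 (ha.lt g _ _ h (slot_lt hk))
      rw [abs_of_neg h2] at h1
      linarith [mul_le_mul_of_nonpos_right hW h2.le]
    have hgt : slot q g k < s → 2 ≤ (-1) ^ g * W g * (a g (n + g * q + s) - θ g) := fun h => by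
      have h1 := hK g hg s hs h.ne'
      have h2 := sub_pos.2 (ha.lt g _ _ h hs)
      rw [abs_of_pos h2] at h1
      linarith [mul_le_mul_of_nonneg_right hW h2.le]
    have heq : s = slot q g k → hardTanh (y (n + g * q + slot q g k) +
        W g * (a g (n + g * q + s) - θ g)) = y (n + g * q + s) := by
      rintro rfl
      rw [hθ, sub_self, mul_zero, add_zero, hardTanh_eq_self hy2]
    rcases Nat.even_or_odd g with hg2 | hg2
    · rw [hg2.neg_one_pow, one_mul] at hlt hgt
      simp only [slot, if_pos hg2] at *
      split_ifs with h1 h2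
      · exact hardTanh_of_ge (by linarith [hgt h1])
      · exact heq h2.symm
      · exact hardTanh_of_le (by linarith [hlt (by omega)])
    · rw [hg2.neg_one_pow, neg_one_mul] at hlt hgt
      simp only [slot, if_neg (Nat.not_even_iff_odd.2 hg2)] at *
      split_ifs with h1 h2
      · exact hardTanh_of_ge (by linarith [hlt (by omega)])
      · exact heq (by omega)
      · exact hardTanh_of_le (by linarith [hgt (by omega)])

/-! ### Fitting one chunk of consecutive points with two hidden layers -/

/-- The saturated nodes of alternating orientation add up to `1`, wherever the fitting node is. -/
lemma sum_alternating {q κ : ℕ} (hq : Even q) (hκ : κ < q) (y : ℝ) :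
    ∑ k ∈ Finset.range q,
      (-1 : ℝ) ^ k * (if k < κ then 1 else if k = κ then (-1) ^ k * y else -1) = y + 1 := by
  have hsq : ∀ k : ℕ, (-1 : ℝ) ^ k * (-1) ^ k = 1 := fun k => by rw [← mul_pow]; norm_num
  have h : ∀ r : ℕ, ∑ k ∈ Finset.range r,
      (-1 : ℝ) ^ k * (if k < κ then 1 else if k = κ then (-1) ^ k * y else -1) =
      if r ≤ κ then (1 - (-1) ^ r) / 2 else y + (1 + (-1) ^ r) / 2 := by
    intro r
    induction r with
    | zero => simp
    | succ r ih =>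
      rw [Finset.sum_range_succ, ih, pow_succ]
      rcases lt_trichotomy r κ with h | h | h
      · rw [if_pos h.le, if_pos h, if_pos (Nat.succ_le_of_lt h)]
        ring
      · subst h
        rw [if_pos le_rfl, if_neg (lt_irrefl _), if_pos rfl, if_neg (by omega), ← mul_assoc, hsq]
        ring
      · rw [if_neg (by omega), if_neg (by omega), if_neg (by omega), if_neg (by omega)]
        ring
  rw [h, if_neg (by omega), hq.neg_one_pow]
  ring

lemma sum_neg_one_pow_of_even {q : ℕ} (hq : Even q) :
    ∑ k ∈ Finset.range q, (-1 : ℝ) ^ k = 0 := by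
  rw [neg_one_geom_sum, if_pos hq]

/-- Node `k` is taken with orientation `(-1) ^ k`, so that off the chunk, where all zigzags agree, the
`q` nodes cancel. The sum of `q` second-layer nodes is the label plus `1` on the chunk,
and `0` off the chunk. -/
lemma GroupNodes.exists_chunk {a : ℕ → ℕ → ℝ} {n q : ℕ} (ha : GroupNodes a n q) (p : ℕ)
    (hq : Even q) {y : ℕ → ℝ} (hy : ∀ i, |y i| ≤ 1) :
    ∃ (b : ℕ → ℝ) (W : ℕ → ℕ → ℝ), ∀ i,
      ∑ k ∈ Finset.range q, hardTanh (b k + ∑ g ∈ Finset.range p, W k g * a g i) =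
        if n ≤ i ∧ i < n + p * q then y i + 1 else 0 := by
  have hnode : ∀ k, ∃ (b : ℝ) (W : ℕ → ℝ), ∃ v : ℕ → ℝ, k < q →
      (∀ i, hardTanh (b + ∑ g ∈ Finset.range p, W g * a g i) = (-1) ^ k * v i) ∧
      (∀ i < n, v i = -1) ∧ (∀ i, n + p * q ≤ i → v i = (-1) ^ (p + 1)) ∧
      ∀ g < p, ∀ s < q, v (n + g * q + s) =
        if k < slot q g s then 1 else if k = slot q g s then (-1) ^ k * y (n + g * q + s)
          else -1 := by
    intro k
    by_cases hk : k < q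
    · have hy' : ∀ i, |(-1) ^ k * y i| ≤ 1 := fun i => by
        simpa [abs_mul] using hy i
      obtain ⟨b, W, z, hz, h1, h2, h3⟩ := ha.exists_node p hk hy'
      refine ⟨(-1) ^ k * b, fun g => (-1) ^ k * W g, fun i => hardTanh (z i),
        fun _ => ⟨fun i => ?_, h1, h2, h3⟩⟩
      simp only [mul_assoc]
      rw [← Finset.mul_sum, ← mul_add, ← hz]
      rcases neg_one_pow_eq_or ℝ k with h | h <;> simp [h, hardTanh_neg]
    · exact ⟨0, 0, 0, fun h => absurd h hk⟩
  choose b W v hv using hnode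
  refine ⟨b, W, fun i => ?_⟩
  rw [Finset.sum_congr rfl fun k hk => (hv k (Finset.mem_range.1 hk)).1 i]
  split_ifs with hi
  · obtain ⟨h1, h2⟩ := hi
    obtain ⟨j, rfl⟩ := Nat.exists_eq_add_of_le h1
    have hj : j < p * q := by omega
    have hq0 : 0 < q := Nat.pos_of_ne_zero (by rintro rfl; simp at hj)
    have hg : j / q < p := (Nat.div_lt_iff_lt_mul hq0).2 hj
    have hs : j % q < q := Nat.mod_lt _ hq0
    have hij : n + j = n + j / q * q + j % q := by
      rw [add_assoc, Nat.div_add_mod']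
    rw [hij, ← sum_alternating hq (slot_lt (g := j / q) hs)]
    exact Finset.sum_congr rfl fun k hk => by
      rw [(hv k (Finset.mem_range.1 hk)).2.2.2 _ hg _ hs]
  · rcases Nat.lt_or_ge i n with h | h
    · rw [Finset.sum_congr rfl fun k hk => by
        rw [(hv k (Finset.mem_range.1 hk)).2.1 i h], ← Finset.sum_mul,
        sum_neg_one_pow_of_even hq, zero_mul]
    · rw [Finset.sum_congr rfl fun k hk => by
        rw [(hv k (Finset.mem_range.1 hk)).2.2.1 i (by omega)], ← Finset.sum_mul,
        sum_neg_one_pow_of_even hq, zero_mul]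

/-- The affine function mapping `u` to `-1` and `v` to `1`. -/
noncomputable def ramp (u v t : ℝ) : ℝ := 2 / (v - u) * t + -(u + v) / (v - u)

lemma ramp_eq_sub_one {u v : ℝ} (h : u < v) (t : ℝ) : ramp u v t = 2 * (t - u) / (v - u) - 1 := by
  have := (sub_pos.2 h).ne'
  unfold ramp
  field_simp
  ring

lemma ramp_eq_one_sub {u v : ℝ} (h : u < v) (t : ℝ) : ramp u v t = 1 - 2 * (v - t) / (v - u) := by
  have := (sub_pos.2 h).ne'
  unfold ramp
  field_simp
  ring

/-- Saturation is reached at the neighbours of the group, so the values inside it are strictly between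
`-1` and `1`. Point `i` sits at `τ (i + 1)`, which leaves `τ 0` as the left neighbour of point `0`. -/
lemma groupNodes_ramp {τ : ℕ → ℝ} (hτ : StrictMono τ) (n q : ℕ) :
    GroupNodes (fun g i => hardTanh
      (ramp (τ (n + g * q)) (τ (n + (g + 1) * q + 1)) (τ (i + 1)))) n q := by
  have hlt : ∀ g, τ (n + g * q) < τ (n + (g + 1) * q + 1) := fun g => hτ (by
    rw [Nat.succ_mul]; omega)
  have hpos : ∀ g, 0 < τ (n + (g + 1) * q + 1) - τ (n + g * q) := fun g => sub_pos.2 (hlt g)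
  have hin : ∀ g s, s < q → ramp (τ (n + g * q)) (τ (n + (g + 1) * q + 1))
      (τ (n + g * q + s + 1)) ∈ Set.Ioo (-1 : ℝ) 1 := by
    intro g s hs
    have h1 : τ (n + g * q) < τ (n + g * q + s + 1) := hτ (by omega)
    have h2 : τ (n + g * q + s + 1) < τ (n + (g + 1) * q + 1) := hτ (by
      rw [Nat.succ_mul]; omega)
    constructor
    · rw [ramp_eq_sub_one (hlt g)]
      have := div_pos (mul_pos two_pos (sub_pos.2 h1)) (hpos g)
      linarith
    · rw [ramp_eq_one_sub (hlt g)]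
      have := div_pos (mul_pos two_pos (sub_pos.2 h2)) (hpos g)
      linarith
  refine ⟨fun g i hi => hardTanh_of_le ?_, fun g i hi => hardTanh_of_ge ?_, fun g s hs => ?_,
    fun g s s' hs hs' => ?_⟩
  · rw [ramp_eq_sub_one (hlt g)]
    have : τ (i + 1) ≤ τ (n + g * q) := hτ.monotone (by omega)
    have := div_nonpos_of_nonpos_of_nonneg (by linarith : 2 * (τ (i + 1) - τ (n + g * q)) ≤ 0)
      (hpos g).le
    linarith
  · rw [ramp_eq_one_sub (hlt g)]
    have : τ (n + (g + 1) * q + 1) ≤ τ (i + 1) := hτ.monotone (by omega)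
    have := div_nonpos_of_nonpos_of_nonneg
      (by linarith : 2 * (τ (n + (g + 1) * q + 1) - τ (i + 1)) ≤ 0) (hpos g).le
    linarith
  · rw [hardTanh_eq_self (Set.Ioo_subset_Icc_self (hin g s hs))]
    exact hin g s hs
  · rw [hardTanh_eq_self (Set.Ioo_subset_Icc_self (hin g s (hs.trans hs'))),
      hardTanh_eq_self (Set.Ioo_subset_Icc_self (hin g s' hs')), ramp_eq_sub_one (hlt g),
      ramp_eq_sub_one (hlt g)]
    have h1 : τ (n + g * q + s + 1) < τ (n + g * q + s' + 1) := hτ (by omega)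
    have := hpos g
    gcongr

open Classical in
/-- Two hidden layers with `p` and `dy * q` nodes fit the labels of a chunk of `p * q` consecutive
points, while the functions in `K` are passed on. -/
lemma Reachable.chunk {N : ℕ} {d : ℕ → ℕ} {x : Fin N → Fin (d 0) → ℝ} {l : ℕ}
    {G : Set (Fin N → ℝ)} (h : Reachable d x l (affineHull G)) {τ : ℕ → ℝ} (hτ : StrictMono τ)
    (hτG : (fun i : Fin N => τ (i + 1)) ∈ affineHull G) (K : Finset (Fin N → ℝ))
    (hKG : (K : Set (Fin N → ℝ)) ⊆ affineHull G) (hK : ∀ f ∈ K, ∀ i, f i ∈ Set.Icc (-1 : ℝ) 1)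
    {dy : ℕ} {y : Fin dy → ℕ → ℝ} (hy : ∀ c i, |y c i| ≤ 1) {n p q : ℕ} (hq : Even q)
    (hp : K.card + p ≤ d (l + 1)) (hdq : K.card + dy * q ≤ d (l + 2)) :
    Reachable d x (l + 2) (affineHull ((K : Set (Fin N → ℝ)) ∪ Set.range fun (c : Fin dy)
      (i : Fin N) => if n ≤ (i : ℕ) ∧ (i : ℕ) < n + p * q then y c i + 1 else 0)) := by
  set a : ℕ → ℕ → ℝ := fun g i =>
    hardTanh (ramp (τ (n + g * q)) (τ (n + (g + 1) * q + 1)) (τ (i + 1))) with ha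
  have hKself : ∀ f ∈ K, ∀ i, f i = hardTanh (f i) := fun f hf i =>
    (hardTanh_eq_self (hK f hf i)).symm
  choose b W hbW using fun c => (groupNodes_ramp hτ n q).exists_chunk p hq (hy c)
  have h1 := h.succ (K ∪ (Finset.range p).image fun g (i : Fin N) => a g i)
    ((Finset.card_union_le _ _).trans ((add_le_add_right
      (Finset.card_image_le.trans (Finset.card_range p).le) _).trans hp)) (by
    intro f hf
    rcases Finset.mem_union.1 hf with hf | hf
    · exact ⟨f, hKG hf, hKself f hf⟩
    · obtain ⟨g, -, rfl⟩ := Finset.mem_image.1 hf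
      exact ⟨_, affineHull.affine_mem hτG _ _, fun i => rfl⟩)
  have h2 := h1.succ (K ∪ (Finset.univ ×ˢ Finset.range q).image fun (ck : Fin dy × ℕ) (i : Fin N) =>
      hardTanh (b ck.1 ck.2 + ∑ g ∈ Finset.range p, W ck.1 ck.2 g * a g i))
    ((Finset.card_union_le _ _).trans ((add_le_add_right
      (Finset.card_image_le.trans (by simp)) _).trans hdq)) (by
    intro f hf
    rcases Finset.mem_union.1 hf with hf | hf
    · exact ⟨f, affineHull.mem_of_mem (by simp [hf]), hKself f hf⟩
    · obtain ⟨⟨c, k⟩, -, rfl⟩ := Finset.mem_image.1 hf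
      refine ⟨_, ?_, fun i => rfl⟩
      refine (affineHull _).add_mem (affineHull.const_mem _)
        (affineHull.sum_mem _ fun g hg => (affineHull _).smul_mem (W c k g)
          (affineHull.mem_of_mem ?_))
      exact Finset.mem_coe.2 (Finset.mem_union_right _ (Finset.mem_image_of_mem _ hg)))
  refine h2.mono (affineHull.le_affineHull_iff.2 (Set.union_subset (fun f hf => ?_) ?_))
  · exact affineHull.mem_of_mem (by simp [Finset.mem_coe.1 hf])
  · rintro _ ⟨c, rfl⟩
    simp only [← hbW]
    refine affineHull.sum_mem (f := fun k (i : Fin N) =>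
      hardTanh (b c k + ∑ g ∈ Finset.range p, W c k g * a g i)) _ fun k hk =>
      affineHull.mem_of_mem (Finset.mem_coe.2 (Finset.mem_union_right _ (Finset.mem_image.2
        ⟨(c, k), Finset.mem_product.2 ⟨Finset.mem_univ _, hk⟩, rfl⟩)))

/-! ### Projecting and sorting the sample -/

/-- A generic linear functional, suitably scaled, separates the inputs and has values in `[-1, 1]`.
Its values, in increasing order, are embedded at the indices `1, …, N` of a strictly increasing
sequence `τ`. -/
lemma exists_sorting_projection {N n : ℕ} (x : Fin N → Fin n → ℝ) (hx : Function.Injective x) :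
    ∃ (π : Equiv.Perm (Fin N)) (w : Fin n → ℝ) (τ : ℕ → ℝ), StrictMono τ ∧
      (∀ i : Fin N, τ (i + 1) = w ⬝ᵥ x (π i)) ∧ ∀ i : Fin N, τ (i + 1) ∈ Set.Icc (-1 : ℝ) 1 := by
  obtain ⟨f, hf⟩ := Module.exists_dual_forall_apply_ne_zero (K := ℝ)
    (fun ij : {ij : Fin N × Fin N // ij.1 ≠ ij.2} => x ij.1.1 - x ij.1.2)
    fun ij => sub_ne_zero.2 fun h => ij.2 (hx h)
  set C : ℝ := 1 + ∑ i, |f (x i)| with hC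
  have hCpos : 0 < C := by positivity
  set t : Fin N → ℝ := fun i => C⁻¹ * f (x i) with ht
  have ht1 : ∀ i, |t i| ≤ 1 := fun i => by
    rw [ht, abs_mul, abs_inv, abs_of_pos hCpos, inv_mul_le_one₀ hCpos]
    have := Finset.single_le_sum (f := fun i => |f (x i)|) (fun i _ => abs_nonneg _)
      (Finset.mem_univ i)
    linarith
  have htinj : Function.Injective t := fun i j h => by
    by_contra hij
    refine hf ⟨(i, j), hij⟩ ?_
    rw [map_sub, sub_eq_zero]
    exact mul_left_cancel₀ (inv_pos.2 hCpos).ne' h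
  set π := Tuple.sort t
  have hmono : StrictMono (t ∘ π) :=
    (Tuple.monotone_sort t).strictMono_of_injective (htinj.comp π.injective)
  have hτ : ∀ i : Fin N, (if h : 0 < (i + 1 : ℕ) ∧ (i + 1 : ℕ) - 1 < N
      then t (π ⟨(i + 1 : ℕ) - 1, h.2⟩)
      else if (i + 1 : ℕ) = 0 then -2 else ((i + 1 : ℕ) : ℝ) + 1) = t (π i) := fun i => by
    simp
  refine ⟨π, fun c => C⁻¹ * f (Pi.single c 1), fun k =>
    if h : 0 < k ∧ k - 1 < N then t (π ⟨k - 1, h.2⟩) else if k = 0 then -2 else (k : ℝ) + 1,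
    ?_, fun i => ?_, fun i => ?_⟩
  · intro k k' hk
    have hb := fun i => abs_le.1 (ht1 i)
    have hk' : ((k : ℝ)) < k' := by exact_mod_cast hk
    dsimp only
    split_ifs with h1 h2 h3 h4 h5 h6 h7
    · exact hmono (a := ⟨k - 1, h1.2⟩) (b := ⟨k' - 1, h2.2⟩) (by
        simp only [Fin.mk_lt_mk]; omega)
    · omega
    · have : (0 : ℝ) < k := by exact_mod_cast h1.1
      linarith [(hb (π ⟨k - 1, h1.2⟩)).2]
    · linarith [(hb (π ⟨k' - 1, h5.2⟩)).1]
    · omega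
    · have : (0 : ℝ) ≤ k' := Nat.cast_nonneg k'
      linarith
    · omega
    · omega
    · linarith
  · refine (hτ i).trans ?_
    rw [ht]
    dsimp only
    rw [LinearMap.pi_apply_eq_sum_univ f, dotProduct, Finset.mul_sum]
    refine Finset.sum_congr rfl fun c _ => ?_
    rw [smul_eq_mul, mul_assoc, mul_comm (f _)]
    congr 3
    ext j
    simp [Pi.single_apply, eq_comm]
  · have := hτ i
    dsimp only
    rw [this]
    exact abs_le.1 (ht1 _)

/-! ### Chaining the chunks -/

open Classical in
/-- Memorization by blocks of two consecutive hidden layers, where block `j` fits the `j`-th chunk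
of `p j * q j` points. The features passed between the blocks are the projected input and, for
each output coordinate, the labels of the points of the first `j` chunks, continued by `-1`. -/
theorem finiteSampleExpressive_of_blocks {L : ℕ} {d : ℕ → ℕ} {N m : ℕ} {l p q : ℕ → ℕ}
    (hd : ∀ k, 1 ≤ k → k ≤ L → 1 ≤ d k) (hm : 1 ≤ m)
    (hl : ∀ j, 1 ≤ j → j ≤ m → 1 ≤ l j ∧ l j + 2 ≤ L)
    (hgap : ∀ j, 1 ≤ j → j + 1 ≤ m → l j + 1 < l (j + 1))
    (hp : ∀ j, 1 ≤ j → j ≤ m → reservedNodes (d L) m j + p j ≤ d (l j))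
    (hq : ∀ j, 1 ≤ j → j ≤ m → reservedNodes (d L) m j + d L * q j ≤ d (l j + 1))
    (heven : ∀ j, Even (q j))
    (hN : N ≤ ∑ j ∈ Finset.Icc 1 m, p j * q j)
    (hmid : ∀ j, 1 ≤ j → j + 1 ≤ m → ∀ k, l j + 2 ≤ k → k + 1 ≤ l (j + 1) → d L + 1 ≤ d k)
    (hend : ∀ k, l m + 2 ≤ k → k + 1 ≤ L → d L ≤ d k) :
    FiniteSampleExpressive hardTanh d L N := by
  intro x₀ hx₀ y₀ hy₀
  obtain ⟨π, w, τ, hτ, hτw, hτ1⟩ := exists_sorting_projection x₀ hx₀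
  set x : Fin N → Fin (d 0) → ℝ := fun i => x₀ (π i) with hx
  set y : Fin (d L) → ℕ → ℝ := fun c i => if h : i < N then y₀ (π ⟨i, h⟩) c else 0 with hy
  have hy1 : ∀ c i, |y c i| ≤ 1 := fun c i => by
    simp only [hy]
    split_ifs with h
    · exact abs_le.2 (hy₀ _ _)
    · simp
  have hyx : ∀ c (i : Fin N), y c i = y₀ (π i) c := fun c i => by simp [hy]
  set t : Fin N → ℝ := fun i => τ (i + 1) with ht
  set n : ℕ → ℕ := fun j => ∑ i ∈ Finset.Icc 1 j, p i * q i with hn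
  have hn1 : ∀ j, n (j + 1) = n j + p (j + 1) * q (j + 1) := fun j =>
    Finset.sum_Icc_succ_top (by omega) _
  -- The labels of the first `j` chunks, continued by `-1`.
  set S : ℕ → Fin (d L) → Fin N → ℝ := fun j c i => if (i : ℕ) < n j then y c i else -1 with hS
  set T : ℕ → Finset (Fin N → ℝ) := fun j => Finset.univ.image (S j) with hT
  have hTcard : ∀ j, (T j).card ≤ d L := fun j => Finset.card_image_le.trans (by simp)
  have hT1 : ∀ j, ∀ f ∈ T j, ∀ i, f i ∈ Set.Icc (-1 : ℝ) 1 := by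
    intro j f hf i
    obtain ⟨c, -, rfl⟩ := Finset.mem_image.1 hf
    simp only [hS]
    split_ifs
    · exact abs_le.1 (hy1 c i)
    · simp
  set T' : ℕ → Finset (Fin N → ℝ) := fun j => if 1 < j then T (j - 1) else ∅ with hT'
  set t' : ℕ → Finset (Fin N → ℝ) := fun j => if j < m then {t} else ∅ with ht'
  have ht'1 : ∀ j, ∀ f ∈ t' j, f = t := by
    intro j f hf
    simp only [ht'] at hf
    split_ifs at hf
    · simpa using hf
    · simp at hf
  have ht'card : ∀ j, (t' j).card = if j < m then 1 else 0 := fun j => by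
    simp only [ht']
    split_ifs <;> simp
  have hT'1 : ∀ j, ∀ f ∈ T' j, ∀ i, f i ∈ Set.Icc (-1 : ℝ) 1 := by
    intro j f hf
    simp only [hT'] at hf
    split_ifs at hf
    · exact hT1 _ f hf
    · simp at hf
  have hcard : ∀ j, (T' j ∪ t' j).card ≤ reservedNodes (d L) m j := by
    intro j
    refine (Finset.card_union_le _ _).trans ?_
    rw [ht'card, reservedNodes]
    refine add_le_add_left ?_ _
    simp only [hT']
    split_ifs
    · simpa using hTcard _
    · simp
  -- One block.
  have hblock : ∀ j, 1 ≤ j → j ≤ m →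
      Reachable d x (l j - 1) (affineHull ((insert t (T' j) : Finset _) : Set (Fin N → ℝ))) →
      Reachable d x (l j + 1) (affineHull ((T j ∪ t' j : Finset _) : Set (Fin N → ℝ))) := by
    intro j hj1 hjm h
    obtain ⟨l', hl'⟩ := Nat.exists_eq_add_of_le' (hl j hj1 hjm).1
    obtain ⟨j, rfl⟩ := Nat.exists_eq_add_of_le' hj1
    have hc := hcard (j + 1)
    have hp' := hp _ hj1 hjm
    have hq' := hq _ hj1 hjm
    rw [hl'] at hp' hq' h ⊢
    refine (h.chunk hτ (affineHull.mem_of_mem (by simp [ht])) (T' (j + 1) ∪ t' (j + 1))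
      (fun f hf => affineHull.mem_of_mem ?_) (fun f hf => ?_) hy1 (n := n j)
      (p := p (j + 1)) (heven (j + 1))
      (le_trans (by omega) hp') (le_trans (by omega) hq')).mono
      (affineHull.le_affineHull_iff.2 fun f hf => ?_)
    · rcases Finset.mem_union.1 (Finset.mem_coe.1 hf) with hf | hf
      · simp [hf]
      · simp [ht'1 _ f hf]
    · rcases Finset.mem_union.1 hf with hf | hf
      · exact hT'1 _ f hf
      · rw [ht'1 _ f hf]
        exact hτ1
    · rcases Finset.mem_union.1 (Finset.mem_coe.1 hf) with hf | hf
      · obtain ⟨c, -, rfl⟩ := Finset.mem_image.1 hf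
        have hsum : S (j + 1) c = S j c + fun i : Fin N =>
            if n j ≤ (i : ℕ) ∧ (i : ℕ) < n j + p (j + 1) * q (j + 1) then y c i + 1 else 0 := by
          ext i
          simp only [hS, hn1, Pi.add_apply]
          split_ifs <;> first | omega | ring
        rw [hsum]
        refine (affineHull _).add_mem ?_ (affineHull.mem_of_mem (Or.inr ⟨c, rfl⟩))
        rcases Nat.eq_zero_or_pos j with rfl | hj
        · have : S 0 c = fun _ => -1 := by
            ext i
            simp [hS, hn]
          rw [this]
          exact affineHull.const_mem _
        · refine affineHull.mem_of_mem (Or.inl (Finset.mem_coe.2 (Finset.mem_union_left _ ?_)))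
          simp only [hT', if_pos (Nat.lt_add_of_pos_left hj), Nat.add_sub_cancel]
          exact Finset.mem_image_of_mem _ (Finset.mem_univ c)
      · exact affineHull.mem_of_mem (Or.inl (Finset.mem_coe.2 (Finset.mem_union_right _ hf)))
  have hreach : ∀ j, 1 ≤ j → j ≤ m → Reachable d x (l j - 1)
      (affineHull ((insert t (T' j) : Finset _) : Set (Fin N → ℝ))) := by
    intro j hj
    induction j, hj using Nat.le_induction with
    | base =>
      intro _
      have h0 : Reachable d x 0 (affineHull (({t} : Finset (Fin N → ℝ)) : Set (Fin N → ℝ))) := by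
        rw [Finset.coe_singleton]
        exact Reachable.input w 0 fun i => by rw [ht, add_zero]; exact hτw i
      have hT'e : insert t (T' 1) = {t} := by simp [hT']
      rw [hT'e]
      refine h0.pass (by simpa using hτ1) _ (Nat.zero_le _) fun k hk1 hk2 => ?_
      have := hl 1 le_rfl hm
      simpa using hd k (by omega) (by omega)
    | succ j hj ih =>
      intro hjm
      have hT'e : insert t (T' (j + 1)) = T j ∪ t' j := by
        simp only [hT', ht', if_pos (Nat.lt_succ_of_le hj), if_pos (Nat.lt_of_succ_le hjm),
          Nat.add_sub_cancel]
        rw [Finset.union_comm, Finset.insert_eq]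
      have hg := hgap j hj hjm
      rw [hT'e]
      refine (hblock j hj (by omega) (ih (by omega))).pass (fun f hf => ?_) _ (by omega)
        fun k hk1 hk2 => ?_
      · rcases Finset.mem_union.1 hf with hf | hf
        · exact hT1 _ f hf
        · rw [ht'1 _ f hf]
          exact hτ1
      · refine le_trans ?_ (hmid j hj hjm k (by omega) (by omega))
        refine (Finset.card_union_le _ _).trans (add_le_add (hTcard j) ?_)
        rw [ht'card]
        split_ifs <;> simp
  have hlm := hl m hm le_rfl
  have hlast : Reachable d x (L - 1) (affineHull ((T m : Finset _) : Set (Fin N → ℝ))) := by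
    have h := hblock m hm le_rfl (hreach m hm le_rfl)
    rw [show T m ∪ t' m = T m by simp [ht']] at h
    exact h.pass (hT1 m) _ (by omega) fun k hk1 hk2 =>
      (hTcard m).trans (hend k (by omega) (by omega))
  obtain ⟨L, rfl⟩ := Nat.exists_eq_add_of_le' (show 1 ≤ L by omega)
  obtain ⟨θ, hθ⟩ := hlast.exists_output (y := fun i => y₀ (π i)) fun c => by
    refine affineHull.mem_of_mem (Finset.mem_coe.2 (Finset.mem_image.2 ⟨c, Finset.mem_univ _, ?_⟩))
    ext i
    simp only [hS]
    rw [if_pos (i.2.trans_le hN), hyx]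
  exact ⟨θ, fun i => by simpa [hx] using hθ (π.symm i)⟩

/-- Rounding the free widths down to even numbers gives the chunk sizes: the second layer of a block
needs `q j` nodes for each output coordinate, and `q j` is even so that alternating signs cancel. -/
theorem finiteSampleExpressive_of_width {L : ℕ} {d : ℕ → ℕ} {N m : ℕ} {l : ℕ → ℕ}
    (hd : ∀ k, 1 ≤ k → k ≤ L → 1 ≤ d k) (hm : 1 ≤ m)
    (hl : ∀ j, 1 ≤ j → j ≤ m → 1 ≤ l j ∧ l j + 2 ≤ L)
    (hgap : ∀ j, 1 ≤ j → j + 1 ≤ m → l j + 1 < l (j + 1))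
    (hr : ∀ j, 1 ≤ j → j ≤ m →
      reservedNodes (d L) m j ≤ d (l j) ∧ reservedNodes (d L) m j ≤ d (l j + 1))
    (hN : N ≤ 4 * ∑ j ∈ Finset.Icc 1 m,
      ((d (l j) - reservedNodes (d L) m j) / 2) *
        ((d (l j + 1) - reservedNodes (d L) m j) / (2 * d L)))
    (hmid : ∀ j, 1 ≤ j → j + 1 ≤ m → ∀ k, l j + 2 ≤ k → k + 1 ≤ l (j + 1) → d L + 1 ≤ d k)
    (hend : ∀ k, l m + 2 ≤ k → k + 1 ≤ L → d L ≤ d k) :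
    FiniteSampleExpressive hardTanh d L N := by
  refine finiteSampleExpressive_of_blocks hd hm hl hgap
    (p := fun j => 2 * ((d (l j) - reservedNodes (d L) m j) / 2))
    (q := fun j => 2 * ((d (l j + 1) - reservedNodes (d L) m j) / (2 * d L)))
    (fun j h1 h2 => ?_) (fun j h1 h2 => ?_) (fun j => even_two_mul _) (hN.trans_eq ?_) hmid hend
  · have := hr j h1 h2
    omega
  · have := hr j h1 h2
    have h3 := Nat.mul_div_le (d (l j + 1) - reservedNodes (d L) m j) (2 * d L)
    rw [← mul_assoc, mul_comm (d L) 2]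
    omega
  · rw [Finset.mul_sum]
    exact Finset.sum_congr rfl fun j _ => by ring

/-! ### Memorization capacity -/

lemma le_memorizationCapacity {σ : ℝ → ℝ} {d : ℕ → ℕ} {L N : ℕ}
    (h : FiniteSampleExpressive σ d L N) : (N : ℕ∞) ≤ memorizationCapacity σ d L :=
  le_iSup (fun N : {N : ℕ // FiniteSampleExpressive σ d L N} => ((N : ℕ) : ℕ∞)) ⟨N, h⟩

/-- Every second pair of adjacent hidden layers can be used as a block. -/
lemma sum_le_memorizationCapacity {L : ℕ} {d : ℕ → ℕ} (hL : 3 ≤ L) (hdL : d L = 1)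
    (hd : ∀ k, 1 ≤ k → k + 1 ≤ L → 4 ≤ d k) {s m : ℕ} (hs : 1 ≤ s) (hsm : 2 * m + s ≤ L) :
    ((∑ j ∈ Finset.Icc 1 m, d (2 * j + s - 2) * d (2 * j + s - 2 + 1) : ℕ) : ℕ∞) ≤
      9 * memorizationCapacity hardTanh d L := by
  rcases Nat.eq_zero_or_pos m with rfl | hm
  · simp
  have hr : ∀ j, reservedNodes (d L) m j ≤ 2 := fun j => by
    rw [reservedNodes, hdL]
    split_ifs <;> omega
  have hfse := finiteSampleExpressive_of_width (d := d) (L := L) (m := m)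
    (l := fun j => 2 * j + s - 2) (fun k h1 h2 => ?_) hm (fun j h1 h2 => ?_) (fun j h1 h2 => ?_)
    (fun j h1 h2 => ?_) le_rfl (fun j h1 h2 k h3 h4 => ?_) (fun k h3 h4 => ?_)
  · refine le_trans ?_ (mul_le_mul_right (le_memorizationCapacity hfse) _)
    norm_cast
    rw [Finset.mul_sum, Finset.mul_sum]
    refine Finset.sum_le_sum fun j hj => ?_
    obtain ⟨h1, h2⟩ := Finset.mem_Icc.1 hj
    -- At most `2` of at least `4` nodes are reserved, and rounding loses at most one more.
    have h3 : ∀ k, 1 ≤ k → k + 1 ≤ L →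
        d k ≤ 6 * ((d k - reservedNodes (d L) m j) / 2) := fun k hk1 hk2 => by
      have := hr j
      have := hd k hk1 hk2
      omega
    have := Nat.mul_le_mul (h3 (2 * j + s - 2) (by omega) (by omega))
      (h3 (2 * j + s - 2 + 1) (by omega) (by omega))
    rw [hdL] at this ⊢
    refine this.trans_eq ?_
    ring
  · rcases Nat.lt_or_ge k L with h | h
    · linarith [hd k h1 h]
    · rw [le_antisymm h2 h, hdL]
  · omega
  · omega
  · exact ⟨(hr j).trans (by linarith [hd (2 * j + s - 2) (by omega) (by omega)]),
      (hr j).trans (by linarith [hd (2 * j + s - 2 + 1) (by omega) (by omega)])⟩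
  · omega
  · linarith [hd k (by omega) h4]

lemma sum_Icc_eq_odd_add_even (D : ℕ → ℕ) (M : ℕ) :
    ∑ k ∈ Finset.Icc 1 M, D k = ∑ j ∈ Finset.Icc 1 ((M + 1) / 2), D (2 * j + 1 - 2) +
      ∑ j ∈ Finset.Icc 1 (M / 2), D (2 * j + 2 - 2) := by
  induction M with
  | zero => simp
  | succ M ih =>
    rw [Finset.sum_Icc_succ_top (by omega), ih]
    rcases Nat.even_or_odd' M with ⟨k, rfl | rfl⟩
    · rw [show (2 * k + 1) / 2 = k by omega, show (2 * k + 1 + 1) / 2 = k + 1 by omega,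
        show 2 * k / 2 = k by omega, Finset.sum_Icc_succ_top (by omega),
        show 2 * (k + 1) + 1 - 2 = 2 * k + 1 by omega]
      ring
    · rw [show (2 * k + 1 + 1) / 2 = k + 1 by omega, show (2 * k + 1 + 1 + 1) / 2 = k + 1 by omega,
        show (2 * k + 1) / 2 = k by omega,
        Finset.sum_Icc_succ_top (b := k) (by omega) (f := fun j => D (2 * j + 2 - 2)),
        show 2 * (k + 1) + 2 - 2 = 2 * k + 1 + 1 by omega]
      ring

theorem hiddenEdgeCount_le {L : ℕ} {d : ℕ → ℕ} (hL : 3 ≤ L) (hdL : d L = 1)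
    (hd : ∀ k, 1 ≤ k → k + 1 ≤ L → 4 ≤ d k) :
    (hiddenEdgeCount d L : ℕ∞) ≤ 18 * memorizationCapacity hardTanh d L := by
  rw [hiddenEdgeCount, sum_Icc_eq_odd_add_even, Nat.cast_add]
  refine (add_le_add
    (sum_le_memorizationCapacity hL hdL hd (s := 1) le_rfl (by omega))
    (sum_le_memorizationCapacity hL hdL hd (s := 2) (by omega) (by omega))).trans_eq ?_
  rw [← add_mul]
  norm_num

/-- The first and the last edge layer are bounded by their adjacent hidden edge layers, up to the
factors `d 0` and `1`. -/
lemma edgeCount_le {L : ℕ} {d : ℕ → ℕ} (hL : 3 ≤ L) (hdL : d L = 1)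
    (hd : ∀ k, 1 ≤ k → k + 1 ≤ L → 4 ≤ d k) :
    edgeCount d L ≤ (d 0 + 2) * hiddenEdgeCount d L := by
  obtain ⟨M, rfl⟩ := Nat.exists_eq_add_of_le' hL
  have h0 : edgeCount d (M + 3) =
      hiddenEdgeCount d (M + 3) + d 0 * d 1 + d (M + 2) * d (M + 3) := by
    rw [edgeCount, hiddenEdgeCount, Finset.sum_range_succ, Finset.sum_range_succ',
      Finset.range_eq_Ico, Finset.sum_Ico_add' (fun k => d k * d (k + 1)) 0 (M + 1) 1]
    rfl
  have h1 : d 1 * d 2 ≤ hiddenEdgeCount d (M + 3) :=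
    Finset.single_le_sum (f := fun k => d k * d (k + 1)) (fun _ _ => Nat.zero_le _)
      (Finset.mem_Icc.2 (by omega) : 1 ∈ Finset.Icc 1 (M + 3 - 2))
  have h2 : d (M + 1) * d (M + 2) ≤ hiddenEdgeCount d (M + 3) :=
    Finset.single_le_sum (f := fun k => d k * d (k + 1)) (fun _ _ => Nat.zero_le _)
      (Finset.mem_Icc.2 (by omega) : M + 1 ∈ Finset.Icc 1 (M + 3 - 2))
  have h3 : d 1 ≤ d 1 * d 2 := Nat.le_mul_of_pos_right _ (by linarith [hd 2 (by omega) (by omega)])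
  have h4 : d (M + 2) ≤ d (M + 1) * d (M + 2) :=
    Nat.le_mul_of_pos_left _ (by linarith [hd (M + 1) (by omega) (by omega)])
  have h5 := Nat.mul_le_mul_left (d 0) (h3.trans h1)
  rw [h0, hdL]
  linarith [h4.trans h2]

theorem proposition3 :
    -- memorization of every dataset under the width condition
    (∀ (L : ℕ) (d : ℕ → ℕ) (N m : ℕ) (l : ℕ → ℕ),
      -- hidden layers and output layer are non-empty
      (∀ k, 1 ≤ k → k ≤ L → 1 ≤ d k) →
      1 ≤ m →
      -- the indices `l_1, …, l_m` lie in `[L - 2]` and are non-adjacent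
      (∀ j, 1 ≤ j → j ≤ m → 1 ≤ l j ∧ l j + 2 ≤ L) →
      (∀ j, 1 ≤ j → j + 1 ≤ m → l j + 1 < l (j + 1)) →
      -- the subtractions and floors below are those of non-negative integers
      (∀ j, 1 ≤ j → j ≤ m →
        reservedNodes (d L) m j ≤ d (l j) ∧ reservedNodes (d L) m j ≤ d (l j + 1)) →
      N ≤ 4 * ∑ j ∈ Finset.Icc 1 m,
        ((d (l j) - reservedNodes (d L) m j) / 2) *
          ((d (l j + 1) - reservedNodes (d L) m j) / (2 * d L)) →
      (∀ j, 1 ≤ j → j + 1 ≤ m → ∀ k, l j + 2 ≤ k → k + 1 ≤ l (j + 1) → d L + 1 ≤ d k) →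
      (∀ k, l m + 2 ≤ k → k + 1 ≤ L → d L ≤ d k) →
      FiniteSampleExpressive hardTanh d L N) ∧
    -- lower bound on the memorization capacity, with an absolute constant
    (∃ C : ℕ, ∀ (L : ℕ) (d : ℕ → ℕ), 3 ≤ L → d L = 1 →
      (∀ k, 1 ≤ k → k + 1 ≤ L → 4 ≤ d k) →
      (hiddenEdgeCount d L : ℕ∞) ≤ C * memorizationCapacity hardTanh d L) ∧
    -- for a fixed input dimension, this is of the order of the number of all edges
    (∀ dx : ℕ, ∃ C : ℕ, ∀ (L : ℕ) (d : ℕ → ℕ), 3 ≤ L → d 0 = dx → d L = 1 →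
      (∀ k, 1 ≤ k → k + 1 ≤ L → 4 ≤ d k) →
      (edgeCount d L : ℕ∞) ≤ C * memorizationCapacity hardTanh d L) := by
  refine ⟨fun L d N m l hd hm hl hgap hr hN hmid hend =>
      finiteSampleExpressive_of_width hd hm hl hgap hr hN hmid hend,
    ⟨18, fun L d hL hdL hd => hiddenEdgeCount_le hL hdL hd⟩,
    fun dx => ⟨(dx + 2) * 18, fun L d hL hd0 hdL hd => ?_⟩⟩
  subst hd0
  calc (edgeCount d L : ℕ∞) ≤ ((d 0 + 2) * hiddenEdgeCount d L : ℕ) :=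
        mod_cast edgeCount_le hL hdL hd
    _ ≤ (d 0 + 2 : ℕ) * (18 * memorizationCapacity hardTanh d L) := by
        rw [Nat.cast_mul]
        gcongr
        exact hiddenEdgeCount_le hL hdL hd
    _ = ((d 0 + 2) * 18 : ℕ) * memorizationCapacity hardTanh d L := by
        rw [← mul_assoc, Nat.cast_mul]
        rfl
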